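/- A \emph{birestriction monoid} is an algebra $(S;\cdot,{}^*,{}^+,1)$ such that $(S;\cdot,1)$ is a monoid and the identities $$xx^*=x,\quad x^*y^*=y^*x^*,\quad (xy^*)^*=x^*y^*,\quad x^*y=y(xy)^*,$$ $$x^+x=x,\quad x^+y^+=y^+x^+,\quad (x^+y)^+=x^+y^+,\quad xy^+=(xy)^+x,$$ $$(x^+)^*=x^+,\quad (x^*)^+=x^*$$ hold. Its projections are the elements of $P(S)=\{s^*: s\in S\}$, its natural partial order is given by $s\le t$ iff $s=et$ for some $e\in P(S)$, and $\sigma$ denotes its minimum congruence that identifies all projections, i.e. $s\mathrel{\sigma}t$ iff $es=et$ for some $e\in P(S)$. It is an \emph{$F$-birestriction monoid} if every $\sigma$-class has a maximum element; the maximum element of the $\sigma$-class of $s$ is denoted $\mathfrak m(s)$, and $F$-birestriction monoids are regarded as algebras of signature $(\cdot,{}^*,{}^+,\mathfrak m,1)$. It is \emph{perfect} if the map $S/\sigma\to S$, $[s]_\sigma\mapsto \mathfrak m(s)$, is a monoid morphism. Perfect $F$-birestriction monoids form a variety, defined by the identities above together with $\mathfrak m(x)x^*=x$, $\mathfrak m(xy^*)=\mathfrak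 m(x)$ and $\mathfrak m(x)\mathfrak m(y)=\mathfrak m(xy)$. Let $\mathsf{FFBR}_p(X)$ denote its free object on the set $X$. \textbf{Corollary.} The word problem for $\mathsf{FFBR}_p(X)$ is decidable. That is: (1) For every effectively coded set $X$ of generators (for example a finite set or $\mathbb N$), there is an algorithm that decides, given two words in prefix notation over $X$ and the symbols $\cdot,{}^*,{}^+,\mathfrak m,1$, whether both are terms and these terms represent the same element of $\mathsf{FFBR}_p(X)$. (2) For arbitrary $X$ there is an algorithm, the same for all $X$, that decides, given two terms $s,t$ in the variables $x_0,x_1,x_2,\dots$ (as words in prefix notation), whether substituting elements of $X$, pairwise distinct for distinct variables that occur in $s$ or $t$, turns $s$ and $t$ into terms that represent the same element of $\mathsf{FFBR}_p(X)$. -/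

import Mathlib

universe u v

/-- A birestriction monoid, an algebra of signature `(·, *, +, 1)`. Here `star x` is `x*` and
`plus x` is `x⁺`. -/
class BirestrictionMonoid (S : Type u) extends Monoid S where
  star : S → S
  plus : S → S
  mul_star : ∀ x : S, x * star x = x
  star_comm : ∀ x y : S, star x * star y = star y * star x
  star_mul_star : ∀ x y : S, star (x * star y) = star x * star y
  star_mul : ∀ x y : S, star x * y = y * star (x * y)
  plus_mul : ∀ x : S, plus x * x = x
  plus_comm : ∀ x y : S, plus x * plus y = plus y * plus x
  plus_plus_mul : ∀ x y : S, plus (plus x * y) = plus x * plus y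
  mul_plus : ∀ x y : S, x * plus y = plus (x * y) * x
  star_plus : ∀ x : S, star (plus x) = plus x
  plus_star : ∀ x : S, plus (star x) = star x

namespace BirestrictionMonoid

variable {S : Type u} [BirestrictionMonoid S]

/-- The set `P(S) = {s* : s ∈ S}` of projections. -/
def IsProjection (e : S) : Prop := ∃ s : S, star s = e

/-- The natural partial order: `s ≤ t` iff `s = e t` for some projection `e`. -/
def NatLE (s t : S) : Prop := ∃ e : S, IsProjection e ∧ s = e * t

/-- The minimum congruence identifying all projections: `s σ t` iff `e s = e t` for some
projection `e`. -/
def Sigma (s t : S) : Prop := ∃ e : S, IsProjection e ∧ e * s = e * t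

theorem isProjection_star (s : S) : IsProjection (star s) := ⟨s, rfl⟩

theorem isProjection_plus (s : S) : IsProjection (plus s) := ⟨plus s, star_plus s⟩

theorem IsProjection.comm {e f : S} (he : IsProjection e) (hf : IsProjection f) :
    e * f = f * e := by
  obtain ⟨s, rfl⟩ := he
  obtain ⟨t, rfl⟩ := hf
  exact star_comm s t

theorem IsProjection.idem {e : S} (he : IsProjection e) : e * e = e := by
  obtain ⟨s, rfl⟩ := he
  rw [← star_mul_star, mul_star]

theorem IsProjection.star_eq {e : S} (he : IsProjection e) : star e = e := by
  obtain ⟨s, rfl⟩ := he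
  rw [← plus_star s, star_plus]

theorem IsProjection.plus_eq {e : S} (he : IsProjection e) : plus e = e := by
  obtain ⟨s, rfl⟩ := he
  exact plus_star s

theorem IsProjection.mul {e f : S} (he : IsProjection e) (hf : IsProjection f) :
    IsProjection (e * f) := by
  obtain ⟨s, rfl⟩ := he
  obtain ⟨t, rfl⟩ := hf
  exact ⟨_, star_mul_star s t⟩

theorem IsProjection.mul_eq {e : S} (he : IsProjection e) (s : S) :
    e * s = s * star (e * s) := by
  have h := star_mul e s
  rwa [he.star_eq] at h

theorem IsProjection.eq_mul {e : S} (he : IsProjection e) (s : S) :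
    s * e = plus (s * e) * s := by
  have h := mul_plus s e
  rwa [he.plus_eq] at h

theorem star_one : star (1 : S) = 1 := by
  have h := mul_star (1 : S)
  rwa [one_mul] at h

theorem sigma_symm {s t : S} (h : Sigma s t) : Sigma t s := by
  obtain ⟨e, he, h⟩ := h
  exact ⟨e, he, h.symm⟩

theorem sigma_trans {s t r : S} (h : Sigma s t) (k : Sigma t r) : Sigma s r := by
  obtain ⟨e, he, h⟩ := h
  obtain ⟨f, hf, k⟩ := k
  refine ⟨f * e, hf.mul he, ?_⟩
  rw [mul_assoc, h, ← mul_assoc, hf.comm he, mul_assoc, k, mul_assoc]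

theorem natLE_antisymm {s t : S} (h : NatLE s t) (k : NatLE t s) : s = t := by
  obtain ⟨e, he, h⟩ := h
  obtain ⟨f, hf, k⟩ := k
  have h1 : e * s = s := by rw [h, ← mul_assoc, he.idem]
  calc s = e * t := h
    _ = e * (f * s) := by rw [← k]
    _ = f * (e * s) := by rw [← mul_assoc, he.comm hf, mul_assoc]
    _ = t := by rw [h1, ← k]

end BirestrictionMonoid

open BirestrictionMonoid in
/-- An `F`-birestriction monoid, an algebra of signature `(·, *, +, mx, 1)`: a birestriction monoid
in which every `σ`-class has a maximum element with respect to the natural partial order, where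
`mx s` is the maximum element of the `σ`-class of `s`. -/
class FBirestrictionMonoid (S : Type u) extends BirestrictionMonoid S where
  mx : S → S
  mx_sigma : ∀ s : S, Sigma (mx s) s
  natLE_mx : ∀ s t : S, Sigma t s → NatLE t (mx s)

/-- An `F`-birestriction monoid is perfect if the map `τ : S/σ → S`, `[s] ↦ mx s`, is a morphism
of monoids. -/
class PerfectFBirestrictionMonoid (S : Type u) extends FBirestrictionMonoid S where
  mx_one : mx (1 : S) = 1
  mx_mul_mx : ∀ s t : S, mx s * mx t = mx (s * t)

namespace FBirestrictionMonoid

open BirestrictionMonoid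

variable {S : Type u} [FBirestrictionMonoid S]

theorem mx_mul_star (s : S) : mx s * star s = s := by
  obtain ⟨e, he, h⟩ := natLE_mx s s ⟨star s, isProjection_star s, rfl⟩
  have h1 := he.mul_eq (mx s)
  rw [← h] at h1
  exact h1.symm

theorem mx_eq_of_sigma {s t : S} (h : Sigma s t) : mx s = mx t :=
  natLE_antisymm (natLE_mx t _ (sigma_trans (mx_sigma s) h))
    (natLE_mx s _ (sigma_trans (mx_sigma t) (sigma_symm h)))

theorem mx_mul_star_right (s t : S) : mx (s * star t) = mx s := by
  refine mx_eq_of_sigma ⟨plus (s * star t), isProjection_plus _, ?_⟩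
  rw [plus_mul, ← (isProjection_star t).eq_mul]

end FBirestrictionMonoid

/-- Terms over `X` in the signature `(·, *, +, mx, 1)`. -/
inductive FTerm (X : Type u) : Type u
  | var : X → FTerm X
  | one : FTerm X
  | mul : FTerm X → FTerm X → FTerm X
  | star : FTerm X → FTerm X
  | plus : FTerm X → FTerm X
  | mx : FTerm X → FTerm X

namespace FTerm

variable {X : Type u}

/-- The value of a term in a perfect `F`-birestriction monoid under an assignment of its
variables. -/
def eval {S : Type v} [PerfectFBirestrictionMonoid S] (f : X → S) : FTerm X → S
  | var x => f x
  | one => 1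
  | mul s t => eval f s * eval f t
  | star s => BirestrictionMonoid.star (eval f s)
  | plus s => BirestrictionMonoid.plus (eval f s)
  | mx s => FBirestrictionMonoid.mx (eval f s)

/-- Renaming of variables. -/
def map {Y : Type v} (f : X → Y) : FTerm X → FTerm Y
  | var x => var (f x)
  | one => one
  | mul s t => mul (map f s) (map f t)
  | star s => star (map f s)
  | plus s => plus (map f s)
  | mx s => mx (map f s)

/-- The set of variables occurring in a term. -/
def vars : FTerm X → Set X
  | var x => {x}
  | one => ∅
  | mul s t => vars s ∪ vars t
  | star s => vars s
  | plus s => vars s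
  | mx s => vars s

/-- The congruence on terms generated by all instances of the identities that define perfect
`F`-birestriction monoids: the identities of birestriction monoids, together with
`mx x · x* = x`, `mx (x y*) = mx x` and `mx x · mx y = mx (x y)`. -/
inductive Rel : FTerm X → FTerm X → Prop
  | refl (s) : Rel s s
  | symm {s t} : Rel s t → Rel t s
  | trans {s t r} : Rel s t → Rel t r → Rel s r
  | congr_mul {s s' t t'} : Rel s s' → Rel t t' → Rel (mul s t) (mul s' t')
  | congr_star {s s'} : Rel s s' → Rel (star s) (star s')
  | congr_plus {s s'} : Rel s s' → Rel (plus s) (plus s')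
  | congr_mx {s s'} : Rel s s' → Rel (mx s) (mx s')
  | mul_assoc (x y z) : Rel (mul (mul x y) z) (mul x (mul y z))
  | one_mul (x) : Rel (mul one x) x
  | mul_one (x) : Rel (mul x one) x
  | mul_star (x) : Rel (mul x (star x)) x
  | star_comm (x y) : Rel (mul (star x) (star y)) (mul (star y) (star x))
  | star_mul_star (x y) : Rel (star (mul x (star y))) (mul (star x) (star y))
  | star_mul (x y) : Rel (mul (star x) y) (mul y (star (mul x y)))
  | plus_mul (x) : Rel (mul (plus x) x) x
  | plus_comm (x y) : Rel (mul (plus x) (plus y)) (mul (plus y) (plus x))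
  | plus_plus_mul (x y) : Rel (plus (mul (plus x) y)) (mul (plus x) (plus y))
  | mul_plus (x y) : Rel (mul x (plus y)) (mul (plus (mul x y)) x)
  | star_plus (x) : Rel (star (plus x)) (plus x)
  | plus_star (x) : Rel (plus (star x)) (star x)
  | mx_mul_star (x) : Rel (mul (mx x) (star x)) x
  | mx_mul_star_right (x y) : Rel (mx (mul x (star y))) (mx x)
  | mx_mul_mx (x y) : Rel (mul (mx x) (mx y)) (mx (mul x y))

/-- The setoid of `Rel`. -/
def relSetoid (X : Type u) : Setoid (FTerm X) :=
  ⟨Rel, ⟨Rel.refl, Rel.symm, Rel.trans⟩⟩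

theorem Rel.eval_eq {S : Type v} [PerfectFBirestrictionMonoid S] (f : X → S) {s t : FTerm X}
    (h : Rel s t) : eval f s = eval f t := by
  induction h with
  | refl s => rfl
  | symm _ ih => exact ih.symm
  | trans _ _ ih1 ih2 => exact ih1.trans ih2
  | congr_mul _ _ ih1 ih2 => simp only [eval, ih1, ih2]
  | congr_star _ ih => simp only [eval, ih]
  | congr_plus _ ih => simp only [eval, ih]
  | congr_mx _ ih => simp only [eval, ih]
  | mul_assoc x y z => exact _root_.mul_assoc _ _ _
  | one_mul x => exact _root_.one_mul _
  | mul_one x => exact _root_.mul_one _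
  | mul_star x => exact BirestrictionMonoid.mul_star _
  | star_comm x y => exact BirestrictionMonoid.star_comm _ _
  | star_mul_star x y => exact BirestrictionMonoid.star_mul_star _ _
  | star_mul x y => exact BirestrictionMonoid.star_mul _ _
  | plus_mul x => exact BirestrictionMonoid.plus_mul _
  | plus_comm x y => exact BirestrictionMonoid.plus_comm _ _
  | plus_plus_mul x y => exact BirestrictionMonoid.plus_plus_mul _ _
  | mul_plus x y => exact BirestrictionMonoid.mul_plus _ _
  | star_plus x => exact BirestrictionMonoid.star_plus _
  | plus_star x => exact BirestrictionMonoid.plus_star _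
  | mx_mul_star x => exact FBirestrictionMonoid.mx_mul_star _
  | mx_mul_star_right x y => exact FBirestrictionMonoid.mx_mul_star_right _ _
  | mx_mul_mx x y => exact PerfectFBirestrictionMonoid.mx_mul_mx _ _

/-- The symbols of which words over `X` in the signature `(·, *, +, mx, 1)` are made: the letters
of `X`, and `0, 1, 2, 3, 4` standing for `1`, `·`, `*`, `+`, `mx` in this order. -/
abbrev Sym (X : Type u) : Type u := X ⊕ Fin 5

/-- A term written as a word, in Polish (prefix) notation. -/
def toWord : FTerm X → List (Sym X)
  | var x => [Sum.inl x]
  | one => [Sum.inr 0]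
  | mul s t => Sum.inr 1 :: (toWord s ++ toWord t)
  | star s => Sum.inr 2 :: toWord s
  | plus s => Sum.inr 3 :: toWord s
  | mx s => Sum.inr 4 :: toWord s

end FTerm

/-- The free perfect `F`-birestriction monoid on `X`. -/
def FFBRp (X : Type u) : Type u := Quotient (FTerm.relSetoid X)

namespace FFBRp

open FTerm BirestrictionMonoid FBirestrictionMonoid

variable {X : Type u}

/-- The element of the free perfect `F`-birestriction monoid that a term represents. -/
def mk (s : FTerm X) : FFBRp X := Quotient.mk (relSetoid X) s

theorem mk_eq_mk {s t : FTerm X} : mk s = mk t ↔ Rel s t := by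
  constructor
  · intro h
    exact Quotient.exact h
  · intro h
    exact Quotient.sound h

theorem mk_surjective (a : FFBRp X) : ∃ s : FTerm X, mk s = a := Quotient.exists_rep a

instance : BirestrictionMonoid (FFBRp X) where
  mul := Quotient.map₂ FTerm.mul fun _ _ h _ _ k => Rel.congr_mul h k
  one := mk FTerm.one
  star := Quotient.map FTerm.star fun _ _ h => Rel.congr_star h
  plus := Quotient.map FTerm.plus fun _ _ h => Rel.congr_plus h
  mul_assoc := by rintro ⟨x⟩ ⟨y⟩ ⟨z⟩; exact Quotient.sound (Rel.mul_assoc x y z)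
  one_mul := by rintro ⟨x⟩; exact Quotient.sound (Rel.one_mul x)
  mul_one := by rintro ⟨x⟩; exact Quotient.sound (Rel.mul_one x)
  mul_star := by rintro ⟨x⟩; exact Quotient.sound (Rel.mul_star x)
  star_comm := by rintro ⟨x⟩ ⟨y⟩; exact Quotient.sound (Rel.star_comm x y)
  star_mul_star := by rintro ⟨x⟩ ⟨y⟩; exact Quotient.sound (Rel.star_mul_star x y)
  star_mul := by rintro ⟨x⟩ ⟨y⟩; exact Quotient.sound (Rel.star_mul x y)
  plus_mul := by rintro ⟨x⟩; exact Quotient.sound (Rel.plus_mul x)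
  plus_comm := by rintro ⟨x⟩ ⟨y⟩; exact Quotient.sound (Rel.plus_comm x y)
  plus_plus_mul := by rintro ⟨x⟩ ⟨y⟩; exact Quotient.sound (Rel.plus_plus_mul x y)
  mul_plus := by rintro ⟨x⟩ ⟨y⟩; exact Quotient.sound (Rel.mul_plus x y)
  star_plus := by rintro ⟨x⟩; exact Quotient.sound (Rel.star_plus x)
  plus_star := by rintro ⟨x⟩; exact Quotient.sound (Rel.plus_star x)

/-- The operation `mx` on the free perfect `F`-birestriction monoid. -/
def mxOp : FFBRp X → FFBRp X := Quotient.map FTerm.mx fun _ _ h => Rel.congr_mx h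

theorem mxOp_mul_star (a : FFBRp X) : mxOp a * star a = a := by
  obtain ⟨s, rfl⟩ := mk_surjective a
  exact Quotient.sound (Rel.mx_mul_star s)

theorem mxOp_mul_star_right (a b : FFBRp X) : mxOp (a * star b) = mxOp a := by
  obtain ⟨s, rfl⟩ := mk_surjective a
  obtain ⟨t, rfl⟩ := mk_surjective b
  exact Quotient.sound (Rel.mx_mul_star_right s t)

theorem eq_plus_mul_mxOp (a : FFBRp X) : a = plus a * mxOp a := by
  have h := (isProjection_star a).eq_mul (mxOp a)
  rwa [mxOp_mul_star] at h

theorem mxOp_eq_of_sigma {a b : FFBRp X} (h : Sigma a b) : mxOp a = mxOp b := by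
  obtain ⟨e, he, h⟩ := h
  have key : ∀ c : FFBRp X, mxOp (e * c) = mxOp c := fun c => by
    rw [he.mul_eq c, mxOp_mul_star_right]
  rw [← key a, h, key b]

instance : PerfectFBirestrictionMonoid (FFBRp X) where
  mx := mxOp
  mx_sigma a := ⟨plus a, isProjection_plus a, by rw [← eq_plus_mul_mxOp, plus_mul]⟩
  natLE_mx a b h :=
    ⟨plus b, isProjection_plus b, by rw [← mxOp_eq_of_sigma h, ← eq_plus_mul_mxOp]⟩
  mx_one := by
    have h := mxOp_mul_star (1 : FFBRp X)
    rwa [BirestrictionMonoid.star_one, mul_one] at h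
  mx_mul_mx a b := by
    obtain ⟨s, rfl⟩ := mk_surjective a
    obtain ⟨t, rfl⟩ := mk_surjective b
    exact Quotient.sound (Rel.mx_mul_mx s t)

/-- The universal property: every map from `X` to a perfect `F`-birestriction monoid extends
uniquely to a morphism defined on `FFBRp X`. -/
theorem existsUnique_lift {S : Type v} [PerfectFBirestrictionMonoid S] (f : X → S) :
    ∃! g : FFBRp X → S, (∀ x, g (mk (FTerm.var x)) = f x) ∧ g 1 = 1 ∧
      (∀ a b, g (a * b) = g a * g b) ∧ (∀ a, g (star a) = star (g a)) ∧
      (∀ a, g (plus a) = plus (g a)) ∧ (∀ a, g (mx a) = mx (g a)) := by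
  refine ⟨Quotient.lift (FTerm.eval f) fun _ _ h => Rel.eval_eq f h,
    ⟨fun x => rfl, rfl, ?_, ?_, ?_, ?_⟩, ?_⟩
  · rintro ⟨a⟩ ⟨b⟩; rfl
  · rintro ⟨a⟩; rfl
  · rintro ⟨a⟩; rfl
  · rintro ⟨a⟩; rfl
  · rintro g ⟨hvar, hone, hmul, hstar, hplus, hmx⟩
    funext a
    obtain ⟨s, rfl⟩ := mk_surjective a
    change g (mk s) = FTerm.eval f s
    induction s with
    | var x => exact hvar x
    | one => exact hone
    | mul s t ihs iht => exact (hmul (mk s) (mk t)).trans (by rw [ihs, iht]; rfl)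
    | star s ih => exact (hstar (mk s)).trans (by rw [ih]; rfl)
    | plus s ih => exact (hplus (mk s)).trans (by rw [ih]; rfl)
    | mx s ih => exact (hmx (mk s)).trans (by rw [ih]; rfl)

/-- The word problem for `FFBRp X`, as a set of pairs of words: both words are terms, and these
terms represent the same element of `FFBRp X`. -/
def WordProblem (X : Type u) (p : List (Sym X) × List (Sym X)) : Prop :=
  ∃ s t : FTerm X, s.toWord = p.1 ∧ t.toWord = p.2 ∧ mk s = mk t

end FFBRp

/-! ### Calculus of projections and maxima -/

namespace BirestrictionMonoid

variable {S : Type u} [BirestrictionMonoid S]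

/-! The value of a term factors as a projection times a product of maxima `mx (f x)`, because `mx`
is multiplicative. The projection can be described by a finite part of the Cayley graph of the free
group, in the manner of Munn trees. The free group acts partially on projections: a letter `x` sends
`e` to `(mx (f x) e)⁺`, its inverse sends `e` to `(e mx (f x))*`, and these maps are mutually
inverse up to a projection factor (`letterAct_letterAct_inv`). So the projection is a product of
translates `γ·1` and `γ·(f x)⁺`, recorded as vertices `γ`, some marked by a letter.

Completeness: `eval_eq_datum` computes this normal form from the term alone, so terms with the same
set of marked vertices and the same word agree in every perfect `F`-birestriction monoid. Soundness:
`Rel.graph_eq` shows that the set and the word are invariant under the defining identities. Once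
lists of reduced words are matched with sets of group elements (`datum_represents`),
`mk_eq_mk_iff_datum` reduces the word problem to comparing two finite sets and two words.

A primitive recursive stack machine parses a word and computes its datum, which gives decidability
for coded `X`. For arbitrary `X` the procedure over `ℕ` suffices: a renaming injective on the
occurring variables preserves and reflects equality (`mk_map_eq_iff`). -/

theorem isProjection_one : IsProjection (1 : S) := ⟨1, star_one⟩

theorem plus_mul_plus (s t : S) : plus (s * plus t) = plus (s * t) := by
  rw [mul_plus, plus_plus_mul, plus_comm, ← plus_plus_mul, ← mul_assoc, plus_mul]

theorem star_star_mul (s t : S) : star (star s * t) = star (s * t) := by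
  rw [star_mul, star_mul_star, star_comm, ← star_mul_star, mul_assoc, mul_star]

theorem IsProjection.plus_mul_eq {e : S} (he : IsProjection e) (s : S) :
    plus (e * s) = e * plus s := by
  have h := plus_plus_mul e s
  rwa [he.plus_eq] at h

theorem IsProjection.star_mul_eq {e : S} (he : IsProjection e) (s : S) :
    star (s * e) = star s * e := by
  have h := star_mul_star s e
  rwa [he.star_eq] at h

end BirestrictionMonoid

namespace FBirestrictionMonoid

open BirestrictionMonoid

theorem mx_mx {S : Type u} [FBirestrictionMonoid S] (s : S) : mx (mx s) = mx s :=
  mx_eq_of_sigma (mx_sigma s)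

theorem mx_projection_mul {S : Type u} [FBirestrictionMonoid S] {e : S} (he : IsProjection e)
    (s : S) : mx (e * s) = mx s :=
  mx_eq_of_sigma ⟨e, he, by rw [← mul_assoc, he.idem]⟩

theorem plus_mul_mx {S : Type u} [FBirestrictionMonoid S] (s : S) : plus s * mx s = s := by
  have h := (isProjection_star s).eq_mul (mx s)
  rw [mx_mul_star] at h
  exact h.symm

end FBirestrictionMonoid

/-! ### Marked vertices of the Cayley graph attached to a term -/

namespace FTerm

/-- Left multiplication of a reduced word by a letter in the free group. -/
def consReduce {X : Type u} [DecidableEq X] (a : X × Bool) : List (X × Bool) → List (X × Bool)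
  | [] => [a]
  | b :: w => if b = (a.1, !a.2) then w else a :: b :: w

/-- Left multiplication of a reduced word by a word in the free group. -/
def mulReduce {X : Type u} [DecidableEq X] (g v : List (X × Bool)) : List (X × Bool) :=
  g.foldr consReduce v

/-- A list of generators of projections, each given by a vertex of the Cayley graph of the free
group and an optional mark at this vertex, together with a word over `X`. -/
abbrev Datum (X : Type u) : Type u := List (List (X × Bool) × Option X) × List X

namespace Datum

variable {X : Type u}

/-- The word over `X` as a word over letters and their formal inverses. -/
def letters (g : List X) : List (X × Bool) := g.map fun x => (x, true)

/-- The formal inverse of a word over `X`. -/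
def invLetters (g : List X) : List (X × Bool) := (g.map fun x => (x, false)).reverse

theorem invLetters_cons (x : X) (g : List X) :
    invLetters (x :: g) = invLetters g ++ [(x, false)] := by
  simp [invLetters]

variable [DecidableEq X]

/-- The left translate of a list of marked vertices. -/
def translate (g : List (X × Bool)) (L : List (List (X × Bool) × Option X)) :
    List (List (X × Bool) × Option X) :=
  L.map fun p => (mulReduce g p.1, p.2)

theorem translate_cons (g : List (X × Bool)) (p : List (X × Bool) × Option X)
    (L : List (List (X × Bool) × Option X)) :
    translate g (p :: L) = (mulReduce g p.1, p.2) :: translate g L := rfl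

/-- The vertices of the path in the Cayley graph that starts at the identity and is labelled by
a word over `X`. -/
def path : List X → List (List (X × Bool) × Option X)
  | [] => [([], none)]
  | x :: g => ([], none) :: translate [(x, true)] (path g)

/-- The mark `some x` separates `x` from `mx x`: both have the vertices `1` and `x`, but `x⁺` may
lie strictly below `(mx x)⁺`. -/
def var (x : X) : Datum X := ([([], none), ([(x, true)], none), ([], some x)], [x])

def one : Datum X := ([([], none)], [])

def mul (a b : Datum X) : Datum X := (a.1 ++ translate (letters a.2) b.1, a.2 ++ b.2)

/-- The translation moves the end vertex of the word to the identity. -/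
def star (a : Datum X) : Datum X := (translate (invLetters a.2) a.1, [])

def plus (a : Datum X) : Datum X := (a.1, [])

def mx (a : Datum X) : Datum X := (path a.2, a.2)

end Datum

/-- The datum of a term. -/
def datum {X : Type u} [DecidableEq X] : FTerm X → Datum X
  | var x => Datum.var x
  | one => Datum.one
  | mul s t => Datum.mul (datum s) (datum t)
  | star s => Datum.star (datum s)
  | plus s => Datum.plus (datum s)
  | mx s => Datum.mx (datum s)

/-! ### The partial action of the free group on projections -/

section Action

open BirestrictionMonoid FBirestrictionMonoid PerfectFBirestrictionMonoid

variable {X : Type u} {S : Type v} [PerfectFBirestrictionMonoid S] (f : X → S)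

/-- The action of a letter on projections. -/
def letterAct (a : X × Bool) (e : S) : S :=
  bif a.2 then BirestrictionMonoid.plus (FBirestrictionMonoid.mx (f a.1) * e)
  else BirestrictionMonoid.star (e * FBirestrictionMonoid.mx (f a.1))

/-- The action of a word on projections. -/
def wordAct (w : List (X × Bool)) (e : S) : S := w.foldr (letterAct f) e

/-- The maximum element of the `σ`-class given by a word over `X`. -/
def top (g : List X) : S := (g.map fun x => FBirestrictionMonoid.mx (f x)).prod

/-- The projection given by a mark. -/
def markProj : Option X → S
  | none => 1
  | some x => BirestrictionMonoid.plus (f x)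

/-- The projection given by a list of marked vertices. -/
def listProj (L : List (List (X × Bool) × Option X)) : S :=
  (L.map fun p => wordAct f p.1 (markProj f p.2)).prod

theorem wordAct_cons (a : X × Bool) (w : List (X × Bool)) (e : S) :
    wordAct f (a :: w) e = letterAct f a (wordAct f w e) := rfl

theorem wordAct_append (w w' : List (X × Bool)) (e : S) :
    wordAct f (w ++ w') e = wordAct f w (wordAct f w' e) := List.foldr_append

theorem top_cons (x : X) (g : List X) : top f (x :: g) = FBirestrictionMonoid.mx (f x) * top f g :=
  List.prod_cons

theorem top_append (g h : List X) : top f (g ++ h) = top f g * top f h := by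
  simp [top]

theorem mx_top (g : List X) : FBirestrictionMonoid.mx (top f g) = top f g := by
  induction g with
  | nil => exact mx_one
  | cons x g ih => rw [top_cons, ← mx_mul_mx, ih, mx_mx]

theorem isProjection_letterAct (a : X × Bool) (e : S) : IsProjection (letterAct f a e) := by
  obtain ⟨x, _ | _⟩ := a
  · exact isProjection_star _
  · exact isProjection_plus _

theorem isProjection_wordAct (w : List (X × Bool)) {e : S} (he : IsProjection e) :
    IsProjection (wordAct f w e) := by
  cases w with
  | nil => exact he
  | cons a w => exact isProjection_letterAct f a _

theorem isProjection_markProj (o : Option X) : IsProjection (markProj f o) := by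
  cases o with
  | none => exact isProjection_one
  | some x => exact isProjection_plus _

theorem isProjection_listProj (L : List (List (X × Bool) × Option X)) :
    IsProjection (listProj f L) := by
  induction L with
  | nil => exact isProjection_one
  | cons p L ih =>
    rw [listProj, List.map_cons, List.prod_cons]
    exact (isProjection_wordAct f _ (isProjection_markProj f _)).mul ih

theorem letterAct_mul (a : X × Bool) {e e' : S} (he : IsProjection e) (he' : IsProjection e') :
    letterAct f a (e * e') = letterAct f a e * letterAct f a e' := by
  obtain ⟨x, _ | _⟩ := a
  · simp only [letterAct, cond_false]
    rw [← BirestrictionMonoid.star_mul_star, mul_assoc e (FBirestrictionMonoid.mx _), ← he'.mul_eq, mul_assoc]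
  · simp only [letterAct, cond_true]
    rw [← plus_plus_mul, ← mul_assoc (BirestrictionMonoid.plus _), ← he.eq_mul, mul_assoc]

/-- Moving a projection across `mx (f x)` and back only cuts it down to the domain of the move. -/
theorem letterAct_letterAct_inv (a : X × Bool) {e : S} (he : IsProjection e) :
    letterAct f a (letterAct f (a.1, !a.2) e) = letterAct f a 1 * e := by
  obtain ⟨x, _ | _⟩ := a
  · simp only [letterAct, cond_false, cond_true, Bool.not_false]
    rw [← he.eq_mul, he.star_mul_eq, one_mul]
  · simp only [letterAct, cond_false, cond_true, Bool.not_true]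
    rw [← he.mul_eq, he.plus_mul_eq, mul_one, he.comm (isProjection_plus _)]

theorem wordAct_mul (w : List (X × Bool)) {e e' : S} (he : IsProjection e)
    (he' : IsProjection e') : wordAct f w (e * e') = wordAct f w e * wordAct f w e' := by
  induction w with
  | nil => rfl
  | cons a w ih =>
    rw [wordAct_cons, ih, letterAct_mul f a (isProjection_wordAct f w he)
      (isProjection_wordAct f w he')]
    rfl

theorem wordAct_one_mul (w : List (X × Bool)) {e : S} (he : IsProjection e) :
    wordAct f w 1 * wordAct f w e = wordAct f w e := by
  rw [← wordAct_mul f w isProjection_one he, one_mul]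

theorem letterAct_one_mul (a : X × Bool) {e : S} (he : IsProjection e) :
    letterAct f a 1 * letterAct f a e = letterAct f a e :=
  wordAct_one_mul f [a] he

theorem letterAct_wordAct [DecidableEq X] (a : X × Bool) (w : List (X × Bool)) {e : S}
    (he : IsProjection e) :
    letterAct f a (wordAct f w e) = letterAct f a 1 * wordAct f (consReduce a w) e := by
  cases w with
  | nil => exact (letterAct_one_mul f a he).symm
  | cons b w =>
    rw [consReduce]
    split_ifs with h
    · rw [h, wordAct_cons, letterAct_letterAct_inv f a (isProjection_wordAct f w he)]
    · exact (letterAct_one_mul f a (isProjection_wordAct f (b :: w) he)).symm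

/-- Each cancellation costs a factor `letterAct f a 1`; all these factors are absorbed in `wordAct f
g 1`. -/
theorem wordAct_wordAct [DecidableEq X] (g w : List (X × Bool)) {e : S} (he : IsProjection e) :
    wordAct f g (wordAct f w e) = wordAct f g 1 * wordAct f (mulReduce g w) e := by
  induction g with
  | nil => exact (one_mul _).symm
  | cons a g ih =>
    have h1 := isProjection_wordAct f g isProjection_one
    have h2 := isProjection_wordAct f (mulReduce g w) he
    rw [wordAct_cons, wordAct_cons, ih, letterAct_mul f a h1 h2,
      letterAct_wordAct f a (mulReduce g w) he, ← mul_assoc,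
      (isProjection_letterAct f a (wordAct f g 1)).comm (isProjection_letterAct f a 1),
      letterAct_one_mul f a h1]
    rfl

theorem listProj_append (L L' : List (List (X × Bool) × Option X)) :
    listProj f (L ++ L') = listProj f L * listProj f L' := by
  simp [listProj]

theorem listProj_cons (p : List (X × Bool) × Option X) (L : List (List (X × Bool) × Option X)) :
    listProj f (p :: L) = wordAct f p.1 (markProj f p.2) * listProj f L := by
  simp [listProj]

theorem wordAct_listProj [DecidableEq X] (g : List (X × Bool))
    (L : List (List (X × Bool) × Option X)) :
    wordAct f g (listProj f L) = wordAct f g 1 * listProj f (Datum.translate g L) := by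
  induction L with
  | nil => exact (mul_one _).symm
  | cons p L ih =>
    have hp := isProjection_markProj f p.2
    have h1 := isProjection_wordAct f g (isProjection_one (S := S))
    rw [listProj_cons, wordAct_mul f g (isProjection_wordAct f _ hp) (isProjection_listProj f L),
      ih, wordAct_wordAct f g p.1 hp, Datum.translate_cons, listProj_cons,
      mul_assoc, ← mul_assoc _ (wordAct f g 1),
      (isProjection_wordAct f (mulReduce g p.1) hp).comm h1, mul_assoc (wordAct f g 1),
      ← mul_assoc (wordAct f g 1), h1.idem]

theorem listProj_mul_of_mem {p : List (X × Bool) × Option X}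
    {L : List (List (X × Bool) × Option X)} (h : p ∈ L) :
    wordAct f p.1 (markProj f p.2) * listProj f L = listProj f L := by
  induction L with
  | nil => cases h
  | cons q L ih =>
    have hp := isProjection_wordAct f p.1 (isProjection_markProj f p.2)
    have hq := isProjection_wordAct f q.1 (isProjection_markProj f q.2)
    rw [listProj_cons, ← mul_assoc]
    rcases List.mem_cons.1 h with rfl | h
    · rw [hp.idem]
    · rw [hp.comm hq, mul_assoc, ih h]

theorem listProj_mul_of_subset {L L' : List (List (X × Bool) × Option X)}
    (h : ∀ p ∈ L, p ∈ L') : listProj f L * listProj f L' = listProj f L' := by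
  induction L with
  | nil => exact one_mul _
  | cons p L ih =>
    rw [listProj_cons, mul_assoc, ih fun q hq => h q (List.mem_cons_of_mem p hq),
      listProj_mul_of_mem f (h p List.mem_cons_self)]

/-- Projections commute and are idempotent, so order and multiplicity do not matter. -/
theorem listProj_congr {L L' : List (List (X × Bool) × Option X)} (h : ∀ p, p ∈ L ↔ p ∈ L') :
    listProj f L = listProj f L' := by
  rw [← listProj_mul_of_subset f fun p hp => (h p).2 hp,
    (isProjection_listProj f L').comm (isProjection_listProj f L),
    listProj_mul_of_subset f fun p hp => (h p).1 hp]

theorem wordAct_one_mul_listProj {w : List (X × Bool)} {L : List (List (X × Bool) × Option X)}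
    (h : (w, none) ∈ L) : wordAct f w 1 * listProj f L = listProj f L :=
  listProj_mul_of_mem f h

theorem top_mul (g : List X) {e : S} (he : IsProjection e) :
    top f g * e = wordAct f (Datum.letters g) e * top f g := by
  induction g with
  | nil => exact (one_mul e).trans (mul_one e).symm
  | cons x g ih =>
    rw [top_cons, mul_assoc, ih, ← mul_assoc,
      (isProjection_wordAct f (Datum.letters g) he).eq_mul, mul_assoc]
    rfl

theorem plus_top (g : List X) :
    BirestrictionMonoid.plus (top f g) = wordAct f (Datum.letters g) 1 := by
  induction g with
  | nil => exact isProjection_one.plus_eq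
  | cons x g ih =>
    rw [top_cons, ← plus_mul_plus, ih]
    rfl

/-- By `(ab)* = (a*b)*` the letters act one after another from the left, which is the action of the
inverse word. -/
theorem star_mul_top (g : List X) {e : S} (he : IsProjection e) :
    BirestrictionMonoid.star (e * top f g) = wordAct f (Datum.invLetters g) e := by
  induction g generalizing e with
  | nil => exact (congrArg _ (mul_one e)).trans he.star_eq
  | cons x g ih =>
    rw [top_cons, ← mul_assoc, ← BirestrictionMonoid.star_star_mul, ih (isProjection_star _),
      Datum.invLetters_cons, wordAct_append]
    rfl

end Action

end FTerm

/-! ### Completeness: the normal form of a term -/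

namespace FTerm

section Completeness

open BirestrictionMonoid FBirestrictionMonoid PerfectFBirestrictionMonoid

variable {X : Type u} [DecidableEq X]

namespace Datum

theorem mulReduce_letters (g h : List X) :
    mulReduce (letters g) (letters h) = letters (g ++ h) := by
  induction g with
  | nil => rfl
  | cons x g ih =>
    change consReduce (x, true) (mulReduce (letters g) (letters h)) = _
    rw [ih]
    cases k : g ++ h with
    | nil => simp [letters, consReduce, k]
    | cons y l => simp [letters, consReduce, k]

theorem mulReduce_invLetters (g : List X) : mulReduce (invLetters g) (letters g) = [] := by
  induction g with
  | nil => rfl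
  | cons x g ih =>
    rw [invLetters_cons, mulReduce, List.foldr_append]
    simpa [consReduce, letters, mulReduce] using ih

theorem mulReduce_invLetters_nil (g : List X) : mulReduce (invLetters g) [] = invLetters g := by
  rw [invLetters, ← List.map_reverse]
  induction g.reverse with
  | nil => rfl
  | cons x l ih =>
    change consReduce (x, false) (mulReduce _ []) = _
    rw [ih]
    cases l with
    | nil => rfl
    | cons y l => simp [consReduce]

theorem mem_translate (g : List (X × Bool)) {L : List (List (X × Bool) × Option X)}
    {v : List (X × Bool)} {o : Option X} (h : (v, o) ∈ L) :
    (mulReduce g v, o) ∈ translate g L :=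
  List.mem_map_of_mem (f := fun p : List (X × Bool) × Option X => (mulReduce g p.1, p.2)) h

theorem origin_mem_path (g : List X) : ([], none) ∈ path g := by
  cases g <;> exact List.mem_cons_self

theorem letters_mem_path (g : List X) : (letters g, none) ∈ path g := by
  induction g with
  | nil => exact List.mem_cons_self
  | cons x g ih =>
    have h := mem_translate (letters [x]) ih
    rw [mulReduce_letters] at h
    exact List.mem_cons_of_mem _ h

end Datum

open Datum

/-- These two vertices absorb the factors that `wordAct_listProj` and `plus_top` produce in
`eval_eq_datum`. -/
theorem ends_mem_datum (t : FTerm X) :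
    ([], none) ∈ (datum t).1 ∧ (letters (datum t).2, none) ∈ (datum t).1 := by
  induction t with
  | var x => simp [datum, Datum.var, letters]
  | one => simp [datum, Datum.one, letters]
  | mul s t ihs iht =>
    refine ⟨List.mem_append_left _ ihs.1, List.mem_append_right _ ?_⟩
    have h := mem_translate (letters (datum s).2) iht.2
    rwa [mulReduce_letters] at h
  | star s ih =>
    have h := mem_translate (invLetters (datum s).2) ih.2
    rw [mulReduce_invLetters] at h
    exact ⟨h, h⟩
  | plus s ih => exact ⟨ih.1, ih.1⟩
  | mx s ih => exact ⟨origin_mem_path _, letters_mem_path _⟩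

variable {S : Type v} [PerfectFBirestrictionMonoid S] (f : X → S)

/-- The product of maxima already forces every vertex of its path, so recording the path in the
datum of `mx` does not change the value. -/
theorem listProj_path_mul_top (g : List X) : listProj f (path g) * top f g = top f g := by
  induction g with
  | nil => simp [path, listProj, top, wordAct, markProj]
  | cons x g ih =>
    have hP := isProjection_listProj f (path g)
    have hT := isProjection_listProj f (translate [(x, true)] (path g))
    have h1 := isProjection_wordAct f [(x, true)] (isProjection_one (S := S))
    -- Insert the path projection in front of `top f g` by induction, then move it left across `mx
    -- (f x)`.
    have key : top f (x :: g) = wordAct f [(x, true)] 1 *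
        (listProj f (translate [(x, true)] (path g)) * top f (x :: g)) := by
      have h := top_mul f [x] hP
      rw [show top f [x] = FBirestrictionMonoid.mx (f x) from mul_one _,
        show letters [x] = [(x, true)] from rfl, wordAct_listProj] at h
      rw [top_cons, ← mul_assoc, ← mul_assoc, ← h, mul_assoc, ih]
    have h2 : listProj f (path (x :: g)) = listProj f (translate [(x, true)] (path g)) :=
      (listProj_cons f _ _).trans (one_mul _)
    rw [h2, key, ← mul_assoc, hT.comm h1, mul_assoc, ← mul_assoc (listProj f _), hT.idem]

/-- In a product the second projection moves left across the first product of maxima and gets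
translated. Under `star` the inverse word acts on the projection; under `plus` the projection
survives unchanged; under `mx` it disappears. -/
theorem eval_eq_datum (t : FTerm X) : eval f t = listProj f (datum t).1 * top f (datum t).2 := by
  induction t with
  | var x =>
    -- Since `f x` lies below its maximum, the vertex `x` is implied by the mark at the identity.
    have h : BirestrictionMonoid.plus (FBirestrictionMonoid.mx (f x)) *
        BirestrictionMonoid.plus (f x) = BirestrictionMonoid.plus (f x) := by
      conv_rhs => rw [← FBirestrictionMonoid.plus_mul_mx (f x)]
      rw [(isProjection_plus (f x)).plus_mul_eq, BirestrictionMonoid.plus_comm]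
    simp [datum, Datum.var, listProj, wordAct, letterAct, markProj, top, eval, h,
      FBirestrictionMonoid.plus_mul_mx]
  | one => simp [datum, Datum.one, listProj, wordAct, markProj, top, eval]
  | mul s t ihs iht =>
    have hs := wordAct_one_mul_listProj f (ends_mem_datum s).2
    have ps := isProjection_listProj f (datum s).1
    have p1 := isProjection_wordAct f (letters (datum s).2) (isProjection_one (S := S))
    rw [eval, ihs, iht, datum, Datum.mul, listProj_append, top_append, mul_assoc (listProj f _),
      ← mul_assoc (top f _), top_mul f _ (isProjection_listProj f _), wordAct_listProj]
    conv_rhs => rw [← hs, p1.comm ps]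
    simp only [mul_assoc]
  | star s ih =>
    have h := mem_translate (invLetters (datum s).2) (ends_mem_datum s).1
    rw [mulReduce_invLetters_nil] at h
    rw [eval, ih, star_mul_top f _ (isProjection_listProj f _), wordAct_listProj,
      wordAct_one_mul_listProj f h]
    exact (mul_one _).symm
  | plus s ih =>
    have hs := wordAct_one_mul_listProj f (ends_mem_datum s).2
    have ps := isProjection_listProj f (datum s).1
    have p1 := isProjection_wordAct f (letters (datum s).2) (isProjection_one (S := S))
    rw [eval, ih, ps.plus_mul_eq, plus_top, ps.comm p1, hs]
    exact (mul_one _).symm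
  | mx s ih =>
    rw [eval, ih, mx_projection_mul (isProjection_listProj f _), mx_top]
    exact (listProj_path_mul_top f _).symm

end Completeness

/-! ### Soundness: an invariant in sets of marked group elements -/

section Soundness

variable {X : Type u}

/-- The translate of a set of marked vertices by an element of the free group. -/
def shift (γ : FreeGroup X) (E : Set (FreeGroup X × Option X)) : Set (FreeGroup X × Option X) :=
  {p | (γ⁻¹ * p.1, p.2) ∈ E}

/-- The element of the free group given by a word over `X`. -/
def toFree (g : List X) : FreeGroup X := FreeGroup.mk (Datum.letters g)

/-- The set of vertices of the path that starts at the identity and is labelled by a word. -/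
def pathSet : List X → Set (FreeGroup X × Option X)
  | [] => {(1, none)}
  | x :: g => insert (1, none) (shift (FreeGroup.of x) (pathSet g))

/-- The set of marked vertices and the word over `X` given by a term. -/
def graph : FTerm X → Set (FreeGroup X × Option X) × List X
  | var x => ({(1, none), (FreeGroup.of x, none), (1, some x)}, [x])
  | one => ({(1, none)}, [])
  | mul s t => ((graph s).1 ∪ shift (toFree (graph s).2) (graph t).1, (graph s).2 ++ (graph t).2)
  | star s => (shift (toFree (graph s).2)⁻¹ (graph s).1, [])
  | plus s => ((graph s).1, [])
  | mx s => (pathSet (graph s).2, (graph s).2)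

theorem mem_shift {γ : FreeGroup X} {E : Set (FreeGroup X × Option X)}
    {p : FreeGroup X × Option X} : p ∈ shift γ E ↔ (γ⁻¹ * p.1, p.2) ∈ E := Iff.rfl

theorem shift_one (E : Set (FreeGroup X × Option X)) : shift 1 E = E := by
  ext p; simp [mem_shift]

theorem shift_shift (γ δ : FreeGroup X) (E : Set (FreeGroup X × Option X)) :
    shift γ (shift δ E) = shift (γ * δ) E := by
  ext p; simp [mem_shift, mul_assoc]

theorem shift_union (γ : FreeGroup X) (E F : Set (FreeGroup X × Option X)) :
    shift γ (E ∪ F) = shift γ E ∪ shift γ F := rfl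

theorem shift_subset {γ : FreeGroup X} {E F : Set (FreeGroup X × Option X)} (h : E ⊆ F) :
    shift γ E ⊆ shift γ F := fun _ hp => h hp

theorem shift_singleton (γ δ : FreeGroup X) (o : Option X) :
    shift γ {(δ, o)} = {(γ * δ, o)} := by
  ext ⟨p, q⟩; simp [mem_shift, inv_mul_eq_iff_eq_mul]

theorem toFree_nil : toFree ([] : List X) = 1 := rfl

theorem toFree_append (g h : List X) : toFree (g ++ h) = toFree g * toFree h := by
  simp [toFree, Datum.letters]

theorem toFree_cons (x : X) (g : List X) : toFree (x :: g) = FreeGroup.of x * toFree g :=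
  toFree_append [x] g

theorem mk_invLetters (g : List X) :
    FreeGroup.mk (Datum.invLetters g) = (toFree g)⁻¹ := by
  simp [toFree, Datum.letters, Datum.invLetters, FreeGroup.inv_mk, FreeGroup.invRev,
    Function.comp_def]

theorem origin_mem_pathSet (g : List X) : (1, none) ∈ pathSet g := by
  cases g <;> simp [pathSet]

theorem toFree_mem_pathSet (g : List X) : (toFree g, none) ∈ pathSet g := by
  induction g with
  | nil => simp [pathSet, toFree_nil]
  | cons x g ih => exact Or.inr (by simpa [mem_shift, toFree_cons] using ih)

theorem pathSet_append (g h : List X) :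
    pathSet (g ++ h) = pathSet g ∪ shift (toFree g) (pathSet h) := by
  induction g with
  | nil =>
    rw [List.nil_append, toFree_nil, shift_one]
    exact (Set.union_eq_self_of_subset_left
      (Set.singleton_subset_iff.2 (origin_mem_pathSet h))).symm
  | cons x g ih =>
    rw [List.cons_append, pathSet, pathSet, ih, shift_union, shift_shift, toFree_cons,
      Set.insert_union]

theorem pathSet_subset_graph (t : FTerm X) : pathSet (graph t).2 ⊆ (graph t).1 := by
  induction t with
  | var x =>
    simp [graph, pathSet, shift_singleton, Set.insert_subset_iff]
  | one => exact subset_rfl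
  | mul s t ihs iht =>
    simp only [graph]
    rw [pathSet_append]
    exact Set.union_subset_union ihs (shift_subset iht)
  | star s ih =>
    refine Set.singleton_subset_iff.2 ?_
    change ((toFree (graph s).2)⁻¹⁻¹ * 1, none) ∈ (graph s).1
    rw [inv_inv, mul_one]
    exact ih (toFree_mem_pathSet _)
  | plus s ih => exact Set.singleton_subset_iff.2 (ih (origin_mem_pathSet _))
  | mx s ih => exact subset_rfl

theorem origin_mem_graph (t : FTerm X) : (1, none) ∈ (graph t).1 :=
  pathSet_subset_graph t (origin_mem_pathSet _)

theorem toFree_mem_graph (t : FTerm X) : (toFree (graph t).2, none) ∈ (graph t).1 :=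
  pathSet_subset_graph t (toFree_mem_pathSet _)

/-- The unit laws need the origin and the end vertex to be present, and `mx x · x* = x` needs the
path to be contained in the set. The other identities are formal computations with words and unions
of translates. -/
theorem Rel.graph_eq {s t : FTerm X} (h : Rel s t) : graph s = graph t := by
  induction h with
  | refl s => rfl
  | symm _ ih => exact ih.symm
  | trans _ _ ih1 ih2 => exact ih1.trans ih2
  | congr_mul _ _ ih1 ih2 => simp only [graph, ih1, ih2]
  | congr_star _ ih => simp only [graph, ih]
  | congr_plus _ ih => simp only [graph, ih]
  | congr_mx _ ih => simp only [graph, ih]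
  | one_mul x => simp [graph, toFree_nil, shift_one, origin_mem_graph]
  | mul_one x => simp [graph, shift_singleton, toFree_mem_graph]
  | mx_mul_star x =>
    simp only [graph, shift_shift, mul_inv_cancel, shift_one, List.append_nil,
      Set.union_eq_self_of_subset_left (pathSet_subset_graph x)]
  | mx_mul_mx x y => simp [graph, pathSet_append]
  | star_mul x y =>
    simp only [graph, shift_shift, shift_union, shift_one, toFree_append, toFree_nil,
      List.nil_append, List.append_nil, mul_inv_rev, mul_inv_cancel_left, inv_mul_cancel_right,
      mul_inv_cancel]
    rw [Set.union_eq_self_of_subset_left Set.subset_union_right]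
  | mul_plus x y =>
    simp only [graph, toFree_nil, shift_one, List.append_nil, List.nil_append]
    rw [Set.union_eq_self_of_subset_right Set.subset_union_left]
  | _ =>
    simp [graph, shift_shift, shift_union, shift_one, toFree_append, toFree_nil,
      Set.union_comm, Set.union_left_comm]

end Soundness

/-! ### Lists of reduced words as finite sets of group elements -/

section Interpretation

variable {X : Type u} [DecidableEq X]

/-- A list of marked reduced words represents a set of marked elements of the free group. -/
def Represents (L : List (List (X × Bool) × Option X)) (E : Set (FreeGroup X × Option X)) : Prop :=
  ∀ v o, (v, o) ∈ L ↔ ∃ γ : FreeGroup X, γ.toWord = v ∧ (γ, o) ∈ E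

/-- In front of a reduced word a letter can cancel only against the head, and the remaining tail is
still reduced. -/
theorem consReduce_toWord (a : X × Bool) (γ : FreeGroup X) :
    consReduce a γ.toWord = (FreeGroup.mk [a] * γ).toWord := by
  have h : (FreeGroup.mk [a] * γ).toWord = FreeGroup.reduce (a :: γ.toWord) := by
    conv_lhs => rw [← FreeGroup.mk_toWord (x := γ), FreeGroup.mul_mk, FreeGroup.toWord_mk]
    rfl
  rw [h, FreeGroup.reduce.cons, FreeGroup.reduce_toWord]
  cases γ.toWord with
  | nil => rfl
  | cons b w =>
    have : b = (a.1, !a.2) ↔ a.1 = b.1 ∧ a.2 = !b.2 := by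
      obtain ⟨a, _ | _⟩ := a <;> obtain ⟨b, _ | _⟩ := b <;> simp [eq_comm]
    simp [consReduce, this]

theorem mulReduce_toWord (g : List (X × Bool)) (γ : FreeGroup X) :
    mulReduce g γ.toWord = (FreeGroup.mk g * γ).toWord := by
  induction g with
  | nil => rw [← FreeGroup.one_eq_mk, one_mul]; rfl
  | cons a g ih =>
    change consReduce a (mulReduce g γ.toWord) = _
    rw [ih, consReduce_toWord, ← mul_assoc, FreeGroup.mul_mk]
    rfl

theorem Represents.translate (g : List (X × Bool)) {L : List (List (X × Bool) × Option X)}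
    {E : Set (FreeGroup X × Option X)} (h : Represents L E) :
    Represents (Datum.translate g L) (shift (FreeGroup.mk g) E) := by
  intro v o
  constructor
  · intro hv
    obtain ⟨⟨w, o'⟩, hw, hp⟩ := List.mem_map.1 hv
    obtain ⟨γ, rfl, hγ⟩ := (h w o').1 hw
    obtain ⟨rfl, rfl⟩ := Prod.mk.inj hp
    refine ⟨FreeGroup.mk g * γ, (mulReduce_toWord g γ).symm, ?_⟩
    rwa [mem_shift, inv_mul_cancel_left]
  · rintro ⟨γ, rfl, hγ⟩
    have := Datum.mem_translate g ((h _ o).2 ⟨_, rfl, mem_shift.1 hγ⟩)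
    rwa [mulReduce_toWord, mul_inv_cancel_left] at this

theorem Represents.append {L L' : List (List (X × Bool) × Option X)}
    {E E' : Set (FreeGroup X × Option X)} (h : Represents L E) (h' : Represents L' E') :
    Represents (L ++ L') (E ∪ E') := by
  intro v o
  simp only [List.mem_append, h v o, h' v o, Set.mem_union, and_or_left, exists_or]

theorem represents_nil : Represents ([] : List (List (X × Bool) × Option X)) ∅ := by
  simp [Represents]

theorem Represents.cons {L : List (List (X × Bool) × Option X)}
    {E : Set (FreeGroup X × Option X)} (γ : FreeGroup X) (o : Option X) (h : Represents L E) :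
    Represents ((γ.toWord, o) :: L) (insert (γ, o) E) := by
  refine Represents.append (L := [(γ.toWord, o)]) (fun v o' => ?_) h
  change (v, o') ∈ [(γ.toWord, o)] ↔ ∃ δ : FreeGroup X, δ.toWord = v ∧ (δ, o') = (γ, o)
  simp only [List.mem_singleton, Prod.mk.injEq]
  exact ⟨fun h => ⟨γ, h.1.symm, rfl, h.2⟩, fun ⟨δ, h1, h2, h3⟩ => ⟨h2 ▸ h1.symm, h3⟩⟩

theorem represents_path (g : List X) : Represents (Datum.path g) (pathSet g) := by
  induction g with
  | nil =>
    have h := represents_nil.cons (1 : FreeGroup X) none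
    rwa [insert_empty_eq] at h
  | cons x g ih => exact (ih.translate [(x, true)]).cons 1 none

theorem datum_represents (t : FTerm X) :
    Represents (datum t).1 (graph t).1 ∧ (datum t).2 = (graph t).2 := by
  induction t with
  | var x =>
    refine ⟨?_, rfl⟩
    have h := ((represents_nil.cons (1 : FreeGroup X) (some x)).cons (FreeGroup.of x) none).cons
      1 none
    rwa [insert_empty_eq] at h
  | one => exact ⟨represents_path [], rfl⟩
  | mul s t ihs iht =>
    refine ⟨ihs.1.append ?_, by simp only [datum, graph, Datum.mul, ihs.2, iht.2]⟩
    rw [ihs.2]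
    exact iht.1.translate _
  | star s ih =>
    refine ⟨?_, rfl⟩
    have h := ih.1.translate (Datum.invLetters (datum s).2)
    rw [mk_invLetters] at h
    simpa only [datum, graph, Datum.star, ih.2] using h
  | plus s ih => exact ⟨ih.1, rfl⟩
  | mx s ih =>
    refine ⟨?_, ih.2⟩
    have h := represents_path (datum s).2
    simpa only [datum, graph, Datum.mx, ih.2] using h

/-- Equality of data up to the order and the multiplicity of marked vertices. -/
def Datum.Equiv (a b : Datum X) : Prop :=
  ((∀ p ∈ a.1, p ∈ b.1) ∧ ∀ p ∈ b.1, p ∈ a.1) ∧ a.2 = b.2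

theorem mk_eq_mk_iff_datum {s t : FTerm X} :
    FFBRp.mk s = FFBRp.mk t ↔ (datum s).Equiv (datum t) := by
  constructor
  · intro h
    have hg := (FFBRp.mk_eq_mk.1 h).graph_eq
    obtain ⟨hs, hs'⟩ := datum_represents s
    obtain ⟨ht, ht'⟩ := datum_represents t
    rw [hg] at hs hs'
    exact ⟨⟨fun p hp => (ht p.1 p.2).2 ((hs p.1 p.2).1 hp),
      fun p hp => (hs p.1 p.2).2 ((ht p.1 p.2).1 hp)⟩, hs'.trans ht'.symm⟩
  · rintro ⟨⟨h1, h2⟩, h3⟩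
    -- The normal form is applied in the free object itself, where a term evaluates to its own
    -- class.
    have key : ∀ r : FTerm X, FFBRp.mk r = eval (fun x => FFBRp.mk (var x)) r := fun r => by
      induction r with
      | var x => rfl
      | one => rfl
      | mul r r' ih ih' => rw [eval, ← ih, ← ih']; rfl
      | star r ih => rw [eval, ← ih]; rfl
      | plus r ih => rw [eval, ← ih]; rfl
      | mx r ih => rw [eval, ← ih]; rfl
    rw [key, key, eval_eq_datum, eval_eq_datum, h3,
      listProj_congr _ fun p => ⟨h1 p, h2 p⟩]

end Interpretation

end FTerm

namespace FTerm

/-! ### Unique readability and evaluation on a stack -/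

section Parsing

variable {X : Type u}

/-- The trailing words make the induction pass through the left factor of a product. -/
theorem toWord_append_injective {s t : FTerm X} {w w' : List (Sym X)}
    (h : s.toWord ++ w = t.toWord ++ w') : s = t ∧ w = w' := by
  induction s generalizing t w w' with
  | var x => cases t <;> simp_all [toWord]
  | one => cases t <;> simp_all [toWord]
  | mul a b iha ihb =>
    cases t with
    | mul a' b' =>
      simp only [toWord, List.cons_append, List.append_assoc, List.cons.injEq, true_and] at h
      obtain ⟨rfl, ha⟩ := iha h
      obtain ⟨rfl, hb⟩ := ihb ha
      exact ⟨rfl, hb⟩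
    | _ => simp [toWord] at h
  | star a ih | plus a ih | mx a ih =>
    cases t <;> simp [toWord] at h
    obtain ⟨rfl, ha⟩ := ih h
    exact ⟨rfl, ha⟩

theorem toWord_injective : Function.Injective (toWord : FTerm X → List (Sym X)) := fun s t h =>
  (toWord_append_injective (w := []) (w' := []) (by rw [h])).1

variable [DecidableEq X]

/-- One step of the evaluation of a word in prefix notation, read from right to left, on a stack
of data. -/
def stackStep (c : Sym X) (st : List (Datum X)) : Option (List (Datum X)) :=
  c.casesOn (fun x => some (Datum.var x :: st)) fun i =>
    if i = 0 then some (Datum.one :: st)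
    else st.casesOn none fun a st' =>
      if i = 1 then st'.casesOn none fun b st'' => some (Datum.mul a b :: st'')
      else if i = 2 then some (Datum.star a :: st')
      else if i = 3 then some (Datum.plus a :: st')
      else some (Datum.mx a :: st')

/-- The evaluation of a word in prefix notation on a stack of data. -/
def stackEval (w : List (Sym X)) : Option (List (Datum X)) :=
  w.foldr (fun c o => o.bind (stackStep c)) (some [])

/-- In a product the right factor is read first, so the datum of the left factor ends up on top of
the stack. -/
theorem foldr_stackStep_toWord (t : FTerm X) (st : List (Datum X)) :
    t.toWord.foldr (fun c o => o.bind (stackStep c)) (some st) = some (datum t :: st) := by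
  induction t generalizing st with
  | var x => rfl
  | one => rfl
  | mul s t ihs iht => rw [toWord, List.foldr_cons, List.foldr_append, iht, ihs]; rfl
  | star s ih => rw [toWord, List.foldr_cons, ih]; rfl
  | plus s ih => rw [toWord, List.foldr_cons, ih]; rfl
  | mx s ih => rw [toWord, List.foldr_cons, ih]; rfl

theorem stackEval_toWord (t : FTerm X) : stackEval t.toWord = some [datum t] :=
  foldr_stackStep_toWord t []

/-- This rules out malformed input: a run without underflow has read a concatenation of terms, one
for each stack entry. -/
theorem exists_terms_of_stackEval {w : List (Sym X)} {st : List (Datum X)}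
    (h : stackEval w = some st) :
    ∃ ts : List (FTerm X), w = ts.flatMap toWord ∧ st = ts.map datum := by
  induction w generalizing st with
  | nil => exact ⟨[], rfl, (Option.some.inj h).symm⟩
  | cons c w ih =>
    obtain ⟨st', h', hc⟩ := Option.bind_eq_some_iff.1 h
    obtain ⟨ts, rfl, rfl⟩ := ih h'
    rcases c with x | i
    · exact ⟨var x :: ts, rfl, (Option.some.inj hc).symm⟩
    · fin_cases i
      · exact ⟨one :: ts, rfl, (Option.some.inj hc).symm⟩
      · match ts, hc with
        | [], hc => cases hc
        | [_], hc => cases hc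
        | a :: b :: ts, hc =>
          exact ⟨mul a b :: ts, by simp [toWord], (Option.some.inj hc).symm⟩
      · match ts, hc with
        | [], hc => cases hc
        | a :: ts, hc => exact ⟨star a :: ts, rfl, (Option.some.inj hc).symm⟩
      · match ts, hc with
        | [], hc => cases hc
        | a :: ts, hc => exact ⟨plus a :: ts, rfl, (Option.some.inj hc).symm⟩
      · match ts, hc with
        | [], hc => cases hc
        | a :: ts, hc => exact ⟨mx a :: ts, rfl, (Option.some.inj hc).symm⟩

theorem stackEval_eq_singleton {w : List (Sym X)} {a : Datum X} :
    stackEval w = some [a] ↔ ∃ t : FTerm X, t.toWord = w ∧ datum t = a := by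
  constructor
  · intro h
    obtain ⟨ts, rfl, hts⟩ := exists_terms_of_stackEval h
    obtain ⟨t, rfl, rfl⟩ := List.map_eq_singleton_iff.1 hts.symm
    exact ⟨t, by simp, rfl⟩
  · rintro ⟨t, rfl, rfl⟩
    exact stackEval_toWord t

end Parsing

/-! ### Primitive recursiveness of the operations on data -/

section Computability

open Primrec

variable {X : Type u} [Primcodable X]

theorem primrec_letters : Primrec (Datum.letters : List X → _) :=
  list_map .id (Primrec.pair snd (const true)).to₂

theorem primrec_invLetters : Primrec (Datum.invLetters : List X → _) :=
  list_reverse.comp (list_map .id (Primrec.pair snd (const false)).to₂)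

theorem primrec_datum_var : Primrec (Datum.var : X → Datum X) :=
  Primrec.pair
    (list_cons.comp (const _) (list_cons.comp
      (Primrec.pair (list_cons.comp (Primrec.pair .id (const true)) (const [])) (const none))
      (list_cons.comp (Primrec.pair (const []) option_some) (const []))))
    (list_cons.comp .id (const []))

theorem primrec_datum_plus : Primrec (Datum.plus : Datum X → Datum X) :=
  Primrec.pair fst (const [])

theorem primrecRel_datumEquiv : PrimrecRel (Datum.Equiv : Datum X → Datum X → Prop) := by
  have hmem : PrimrecRel fun (p : List (X × Bool) × Option X) L => p ∈ L :=
    ((Primrec.eq.exists_mem_list).comp snd fst).of_eq fun p => by simp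
  have hsub : PrimrecRel fun (L L' : List (List (X × Bool) × Option X)) => ∀ p ∈ L, p ∈ L' :=
    hmem.forall_mem_list
  exact ((hsub.comp (fst.comp fst) (fst.comp snd)).and
    (hsub.comp (fst.comp snd) (fst.comp fst))).and
    (Primrec.eq.comp (snd.comp fst) (snd.comp snd))

variable [DecidableEq X]

theorem primrec_consReduce : Primrec₂ (consReduce : X × Bool → List (X × Bool) → List (X × Bool)) := by
  refine Primrec.of_eq (f := fun p : (X × Bool) × List (X × Bool) =>
    (p.2.casesOn [p.1] fun b w => if b = (p.1.1, !p.1.2) then w else p.1 :: b :: w :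
      List (X × Bool))) ?_ (by rintro ⟨a, _ | ⟨b, w⟩⟩ <;> rfl)
  have h : Primrec₂ fun (p : (X × Bool) × List (X × Bool)) (q : (X × Bool) × List (X × Bool)) =>
      if q.1 = (p.1.1, !p.1.2) then q.2 else p.1 :: q.1 :: q.2 :=
    (Primrec.ite (Primrec.eq.comp (fst.comp snd)
        (Primrec.pair (fst.comp (fst.comp fst)) (Primrec.not.comp (snd.comp (fst.comp fst)))))
      (snd.comp snd)
      (list_cons.comp (fst.comp fst) (list_cons.comp (fst.comp snd) (snd.comp snd)))).to₂
  exact list_casesOn snd (list_cons.comp fst (const [])) h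

theorem primrec_mulReduce : Primrec₂ (mulReduce : List (X × Bool) → List (X × Bool) → List (X × Bool)) :=
  list_foldr fst snd
    (primrec_consReduce.comp (fst.comp snd) (snd.comp snd)).to₂

theorem primrec_translate : Primrec₂ (Datum.translate : List (X × Bool) → _ → _) :=
  list_map snd (Primrec.pair (primrec_mulReduce.comp (fst.comp fst) (fst.comp snd))
    (snd.comp snd)).to₂

theorem primrec_path : Primrec (Datum.path : List X → _) := by
  -- The recursion along the word is recast as a right fold.
  refine (list_foldr (h := fun _ (p : X × List (List (X × Bool) × Option X)) =>
    ([], none) :: Datum.translate [(p.1, true)] p.2) .id (const [([], none)]) ?_).of_eq ?_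
  · exact (list_cons.comp (const _) (primrec_translate.comp
      (list_cons.comp (Primrec.pair (fst.comp snd) (const true)) (const []))
      (snd.comp snd))).to₂
  · intro g
    induction g with
    | nil => rfl
    | cons x g ih => exact congrArg (fun L => ([], none) :: Datum.translate [(x, true)] L) ih

theorem primrec_datum_mul : Primrec₂ (Datum.mul : Datum X → Datum X → Datum X) :=
  Primrec.pair
    (list_append.comp (fst.comp fst)
      (primrec_translate.comp (primrec_letters.comp (snd.comp fst)) (fst.comp snd)))
    (list_append.comp (snd.comp fst) (snd.comp snd))

theorem primrec_datum_star : Primrec (Datum.star : Datum X → Datum X) :=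
  Primrec.pair (primrec_translate.comp (primrec_invLetters.comp snd) fst) (const [])

theorem primrec_datum_mx : Primrec (Datum.mx : Datum X → Datum X) :=
  Primrec.pair (primrec_path.comp snd) snd

theorem primrec_stackStep :
    Primrec₂ (stackStep : Sym X → List (Datum X) → Option (List (Datum X))) := by
  have push : ∀ {α : Type u} [Primcodable α] {f : α → Datum X} {g : α → List (Datum X)},
      Primrec f → Primrec g → Primrec fun a => some (f a :: g a) := fun hf hg =>
    option_some.comp (list_cons.comp hf hg)
  have isSym : ∀ {α : Type u} [Primcodable α] {f : α → Fin 5} (i : Fin 5), Primrec f →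
      PrimrecPred fun a => f a = i := fun i hf => Primrec.eq.comp hf (const i)
  have hvar : Primrec₂ fun (p : Sym X × List (Datum X)) (x : X) => some (Datum.var x :: p.2) :=
    (push (primrec_datum_var.comp snd) (snd.comp fst)).to₂
  have hmul : Primrec₂ fun (p : ((Sym X × List (Datum X)) × Fin 5) × Datum X × List (Datum X))
      (q : Datum X × List (Datum X)) => some (Datum.mul p.2.1 q.1 :: q.2) :=
    (push (primrec_datum_mul.comp (fst.comp (snd.comp fst)) (fst.comp snd)) (snd.comp snd)).to₂
  have hop : Primrec₂ fun (p : (Sym X × List (Datum X)) × Fin 5) (q : Datum X × List (Datum X)) =>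
      (if p.2 = 1 then q.2.casesOn none fun b st => some (Datum.mul q.1 b :: st)
      else if p.2 = 2 then some (Datum.star q.1 :: q.2)
      else if p.2 = 3 then some (Datum.plus q.1 :: q.2)
      else some (Datum.mx q.1 :: q.2) : Option (List (Datum X))) :=
    (Primrec.ite (isSym 1 (snd.comp fst)) (list_casesOn (snd.comp snd) (const none) hmul)
      (Primrec.ite (isSym 2 (snd.comp fst))
        (push (primrec_datum_star.comp (fst.comp snd)) (snd.comp snd))
        (Primrec.ite (isSym 3 (snd.comp fst))
          (push (primrec_datum_plus.comp (fst.comp snd)) (snd.comp snd))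
          (push (primrec_datum_mx.comp (fst.comp snd)) (snd.comp snd))))).to₂
  exact sumCasesOn fst hvar (Primrec.ite (isSym 0 snd) (push (const _) (snd.comp fst))
    (list_casesOn (snd.comp fst) (const none) hop)).to₂

theorem primrec_stackEval : Primrec (stackEval : List (Sym X) → _) :=
  list_foldr .id (const _)
    (option_bind (snd.comp snd)
      (primrec_stackStep.comp (fst.comp (snd.comp fst)) snd).to₂).to₂

end Computability

/-! ### Injective renaming of variables -/

section Renaming

variable {X : Type u} {Y : Type v}

theorem map_map_eq_self {ν : X → Y} {μ : Y → X} {s : FTerm X} (h : ∀ x ∈ s.vars, μ (ν x) = x) :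
    (s.map ν).map μ = s := by
  induction s with
  | var x => exact congrArg var (h x rfl)
  | one => rfl
  | mul s t ihs iht =>
    exact congrArg₂ mul (ihs fun x hx => h x (Or.inl hx)) (iht fun x hx => h x (Or.inr hx))
  | star s ih => exact congrArg star (ih h)
  | plus s ih => exact congrArg plus (ih h)
  | mx s ih => exact congrArg mx (ih h)

theorem eval_mk_var (ν : X → Y) (s : FTerm X) :
    eval (fun x => FFBRp.mk (var (ν x))) s = FFBRp.mk (s.map ν) := by
  induction s with
  | var x => rfl
  | one => rfl
  | mul s t ihs iht => rw [eval, ihs, iht]; rfl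
  | star s ih => rw [eval, ih]; rfl
  | plus s ih => rw [eval, ih]; rfl
  | mx s ih => rw [eval, ih]; rfl

theorem mk_map_eq_of_mk_eq (ν : X → Y) {s t : FTerm X} (h : FFBRp.mk s = FFBRp.mk t) :
    FFBRp.mk (s.map ν) = FFBRp.mk (t.map ν) := by
  rw [← eval_mk_var, ← eval_mk_var]
  exact (FFBRp.mk_eq_mk.1 h).eval_eq _

/-- Equality survives any renaming; a left inverse of `ν` on the occurring variables, with arbitrary
values elsewhere, undoes it. -/
theorem mk_map_eq_iff [Nonempty X] {ν : X → Y} {s t : FTerm X}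
    (h : Set.InjOn ν (s.vars ∪ t.vars)) :
    FFBRp.mk (s.map ν) = FFBRp.mk (t.map ν) ↔ FFBRp.mk s = FFBRp.mk t := by
  refine ⟨fun hst => ?_, mk_map_eq_of_mk_eq ν⟩
  have hinv := h.leftInvOn_invFunOn
  have := mk_map_eq_of_mk_eq (Function.invFunOn ν (s.vars ∪ t.vars)) hst
  rwa [map_map_eq_self fun x hx => hinv (Or.inl hx),
    map_map_eq_self fun x hx => hinv (Or.inr hx)] at this

end Renaming

end FTerm

/-! ### The decision procedure -/

theorem FFBRp.computablePred_wordProblem (X : Type u) [Primcodable X] :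
    ComputablePred (FFBRp.WordProblem X) := by
  classical
  let parse (w : List (FTerm.Sym X)) : Option (FTerm.Datum X) :=
    -- Exactly the one-element stacks are accepted: the empty stack passes the test on its tail, but
    -- `head?` rejects it.
    (FTerm.stackEval w).bind fun st => if st.tail = [] then st.head? else none
  have hparse : Primrec parse :=
    Primrec.option_bind FTerm.primrec_stackEval (Primrec.ite
      (Primrec.eq.comp (Primrec.list_tail.comp Primrec.snd) (Primrec.const []))
      (Primrec.list_head?.comp Primrec.snd) (Primrec.const none)).to₂
  have hspec (w : List (FTerm.Sym X)) (a : FTerm.Datum X) :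
      parse w = some a ↔ ∃ t : FTerm X, t.toWord = w ∧ t.datum = a := by
    rw [← FTerm.stackEval_eq_singleton]
    rcases h : FTerm.stackEval w with _ | _ | ⟨b, _ | ⟨c, st⟩⟩ <;> simp [parse, h]
  have hprim : PrimrecPred fun p : List (FTerm.Sym X) × List (FTerm.Sym X) =>
      ((parse p.1).bind fun a => (parse p.2).map fun b => decide (a.Equiv b)) = some true :=
    Primrec.eq.comp (Primrec.option_bind (hparse.comp Primrec.fst)
      (Primrec.option_map (hparse.comp (Primrec.snd.comp Primrec.fst))
        (FTerm.primrecRel_datumEquiv.decide.comp (Primrec.snd.comp Primrec.fst)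
          Primrec.snd).to₂).to₂) (Primrec.const _)
  refine hprim.computablePred.of_eq fun p => ?_
  simp only [Option.bind_eq_some_iff, Option.map_eq_some_iff, decide_eq_true_eq, hspec]
  constructor
  · rintro ⟨_, ⟨s, hs, rfl⟩, _, ⟨t, ht, rfl⟩, h⟩
    exact ⟨s, t, hs, ht, FTerm.mk_eq_mk_iff_datum.2 h⟩
  · rintro ⟨s, t, hs, ht, h⟩
    exact ⟨_, ⟨s, hs, rfl⟩, _, ⟨t, ht, rfl⟩, FTerm.mk_eq_mk_iff_datum.1 h⟩

theorem mainTheorem10 :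
    (∀ (X : Type u) [Primcodable X], ComputablePred (FFBRp.WordProblem X)) ∧
    (∃ A : List (FTerm.Sym ℕ) × List (FTerm.Sym ℕ) → Prop, ComputablePred A ∧
      ∀ (X : Type v) (ν : ℕ → X) (s t : FTerm ℕ), Set.InjOn ν (s.vars ∪ t.vars) →
        (A (s.toWord, t.toWord) ↔ FFBRp.mk (s.map ν) = FFBRp.mk (t.map ν))) := by
  refine ⟨fun X _ => FFBRp.computablePred_wordProblem X, FFBRp.WordProblem ℕ,
    FFBRp.computablePred_wordProblem ℕ, fun X ν s t h => ?_⟩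
  rw [FTerm.mk_map_eq_iff h]
  constructor
  · rintro ⟨s', t', hs, ht, hst⟩
    -- Unique readability identifies the parsed terms with the given ones.
    rwa [FTerm.toWord_injective hs, FTerm.toWord_injective ht] at hst
  · exact fun hst => ⟨s, t, rfl, rfl, hst⟩
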